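/- For every $\varepsilon>0$ there is a constant $c=c(\varepsilon)>0$, depending only on $\varepsilon$, such that for every prime $p$, every integer $g$ that is a primitive root modulo $p$ (its residue class has multiplicative order $p-1$), and every real $N$ with $1\le N<p^{1/2}$, $$\frac1p\sum_{x=0}^{p-1}\Bigl|\sum_{1\le n\le N}e^{2\pi i\frac{x}{p}g^n}\Bigr|\ \ge\ c\,N^{\frac1{48}-\varepsilon}.$$ In other words, the left-hand side is $\gg N^{1/48+o(1)}$ as $N\to\infty$, uniformly in $p$ and $g$. -/

import Mathlib

/-- The discrete (normalized) `L¹`-norm of the exponential sum over the powers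
`g, g², …, g^⌊N⌋` modulo `p`, i.e.
`(1/p) ∑_{x=0}^{p-1} |∑_{1 ≤ n ≤ N} e^{2πi (x/p) gⁿ}|`. -/
noncomputable def powerSumL1Norm (p : ℕ) (g : ℤ) (N : ℝ) : ℝ :=
  (1 / (p : ℝ)) * ∑ x ∈ Finset.range p,
    ‖∑ n ∈ Finset.Icc 1 ⌊N⌋₊,
      Complex.exp (2 * (Real.pi : ℂ) * Complex.I * ((x : ℂ) / (p : ℂ)) * (g : ℂ) ^ n)‖

/-- The integer `g` is a primitive root modulo `p` (for `p` prime): its residue class has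
multiplicative order `p - 1`. -/
def IsPrimitiveRootMod (p : ℕ) (g : ℤ) : Prop :=
  orderOf (g : ZMod p) = p - 1

/-! Hölder's inequality, interpolating L² between L¹ and L⁴, bounds the L¹-norm below by `(M ^ 3 /
E) ^ (1 / 2)`, where `M = ⌊N⌋₊` and `E` is the additive energy of `M` consecutive powers of `g`. So
a power saving over the trivial `E ≤ M ^ 3` is needed; `familyEnergy_powers_pow_le` gives `E ^ 21 ≪
M ^ 62` up to logarithms.

If `E` is large, pigeonholing yields a level `τ`, a base point `g ^ b` and many `i` such that `g ^ b
- g ^ i` has at least `τ` representations as a difference of powers. Put `γ = g ^ (i - b)` and let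
`Γ` be the set of these `γ`. Multiplying by a power of `g` preserves representations, so every `s -
s γ` with `s ∈ Γ ∪ Γ / Γ` is a popular difference of `6 M` consecutive powers. The set `P` of those
has size `O(E / τ ^ 2)`, while `Γ * Γ` and `Γ / Γ` have size `O(M)`.

This contradicts a sum-product phenomenon (`card_pow_le_of_sub_mul_mem`). Popular quotients `Λ` of
`Γ` have a small difference set with a large part of `Γ` (`exists_subset_card_sub_popular`), so by
Plünnecke–Ruzsa `3 • Λ - 3 • Λ` is small. But `Λ` contains almost all products from a large set `B`,
up to dilation (`exists_factor_set`), so a pivot argument makes `3 • Λ - 3 • Λ` at least of order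
`#B ^ 2`. -/

open Finset Pointwise

/-! ### Additive growth by pivoting on difference quotients -/

/-- Given `B ⊆ ZMod p` with at least two elements and `|B|² ≤ p`, there are `a b c d ∈ B` with
`c ≠ d` such that either `(x, y) ↦ (c - d) x + (a - b) y + (c - d) y` is injective on `B × B`, or
`(x, y) ↦ (c - d) x + (a - b) y` has at most `2 |B|²` collisions on `B × B`. -/
theorem exists_pivot {p : ℕ} [Fact p.Prime] (B : Finset (ZMod p)) (hB : 2 ≤ #B)
    (hp : #B ^ 2 ≤ p) :
    ∃ a ∈ B, ∃ b ∈ B, ∃ c ∈ B, ∃ d ∈ B, c ≠ d ∧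
      (Set.InjOn (fun q : ZMod p × ZMod p => (c - d) * q.1 + (a - b) * q.2 + (c - d) * q.2)
          (B ×ˢ B : Finset _) ∨
        #{q ∈ (B ×ˢ B) ×ˢ (B ×ˢ B) | (c - d) * q.1.1 + (a - b) * q.1.2 =
          (c - d) * q.2.1 + (a - b) * q.2.2} ≤ 2 * #B ^ 2) := by
  classical
  let R : ZMod p → Prop := fun ξ =>
    ∃ a ∈ B, ∃ b ∈ B, ∃ c ∈ B, ∃ d ∈ B, c ≠ d ∧ ξ * (c - d) = a - b
  obtain ⟨u, hu, v, hv, huv⟩ := Finset.one_lt_card.mp hB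
  -- `R` holds on the difference quotients of `B`. Since `R 0`, either every residue is such a
  -- quotient, or some quotient `ξ` has `ξ + 1` outside, and that boundary point is the pivot.
  by_cases hR : ∀ ξ, R ξ → R (ξ + 1)
  · have hall : ∀ ξ, R ξ := by
      have hn : ∀ n : ℕ, R (n : ZMod p) := by
        intro n
        induction n with
        | zero => exact ⟨u, hu, u, hu, u, hu, v, hv, huv, by simp⟩
        | succ k ih => push_cast; exact hR _ ih
      intro ξ
      have := hn ξ.val
      rwa [ZMod.natCast_zmod_val] at this
    -- average the number of collisions of `x + ξ y` over `ξ`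
    let T : Finset ((ZMod p × ZMod p) × (ZMod p × ZMod p)) := (B ×ˢ B) ×ˢ (B ×ˢ B)
    have hsum : ∑ ξ : ZMod p, #{q ∈ T | q.1.1 + ξ * q.1.2 = q.2.1 + ξ * q.2.2} ≤
        ∑ _ξ : ZMod p, 2 * #B ^ 2 := by
      have h1 : ∑ ξ : ZMod p, #{q ∈ T | q.1.1 + ξ * q.1.2 = q.2.1 + ξ * q.2.2} =
          ∑ q ∈ T, #{ξ : ZMod p | q.1.1 + ξ * q.1.2 = q.2.1 + ξ * q.2.2} := by
        simp only [Finset.card_filter]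
        rw [Finset.sum_comm]
      -- Two distinct points collide for at most one slope `ξ`; only the diagonal collides for all
      -- `p` of them.
      have h2 : ∀ q ∈ T, #{ξ : ZMod p | q.1.1 + ξ * q.1.2 = q.2.1 + ξ * q.2.2} ≤
          1 + (if q.1 = q.2 then p else 0) := by
        intro q _
        split_ifs with h
        · calc _ ≤ #(univ : Finset (ZMod p)) := Finset.card_le_card (Finset.filter_subset _ _)
            _ = p := by rw [Finset.card_univ, ZMod.card]
            _ ≤ _ := by omega
        · rw [add_zero, Finset.card_le_one]
          intro ξ hξ ξ' hξ'
          simp only [Finset.mem_filter, Finset.mem_univ, true_and] at hξ hξ'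
          by_contra hne
          have h3 : (ξ - ξ') * (q.1.2 - q.2.2) = 0 := by linear_combination hξ - hξ'
          rcases mul_eq_zero.mp h3 with h4 | h4
          · exact hne (sub_eq_zero.mp h4)
          · have h5 := sub_eq_zero.mp h4
            apply h
            rw [h5] at hξ
            exact Prod.ext (add_right_cancel hξ) h5
      rw [h1]
      calc _ ≤ ∑ q ∈ T, (1 + (if q.1 = q.2 then p else 0)) := Finset.sum_le_sum h2
        _ = #B ^ 2 * #B ^ 2 + p * #B ^ 2 := by
          rw [Finset.sum_add_distrib]
          congr 1
          · simp [T, Finset.card_product]; ring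
          · simp only [T]
            rw [Finset.sum_product]
            simp only [Finset.sum_ite_eq]
            rw [Finset.sum_congr rfl (fun x hx => if_pos hx)]
            simp [Finset.card_product]; ring
        _ ≤ p * #B ^ 2 + p * #B ^ 2 := by gcongr
        _ = _ := by simp [ZMod.card]; ring
    obtain ⟨ξ, -, hξ⟩ := Finset.exists_le_of_sum_le Finset.univ_nonempty hsum
    obtain ⟨a, ha, b, hb, c, hc, d, hd, hcd, he⟩ := hall ξ
    refine ⟨a, ha, b, hb, c, hc, d, hd, hcd, Or.inr (le_trans (le_of_eq ?_) hξ)⟩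
    congr 1
    apply Finset.filter_congr
    intro q _
    have h0 : c - d ≠ 0 := sub_ne_zero.mpr hcd
    rw [← he]
    constructor
    · intro h
      apply mul_left_cancel₀ h0
      linear_combination h
    · intro h
      linear_combination (c - d) * h
  · push Not at hR
    obtain ⟨ξ, ⟨a, ha, b, hb, c, hc, d, hd, hcd, he⟩, hξ⟩ := hR
    refine ⟨a, ha, b, hb, c, hc, d, hd, hcd, Or.inl ?_⟩
    rintro ⟨x, y⟩ hq ⟨x', y'⟩ hq' h
    simp only [Finset.coe_product, Set.mem_prod, Finset.mem_coe] at hq hq' h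
    have h0 : c - d ≠ 0 := sub_ne_zero.mpr hcd
    have h1 : x + (ξ + 1) * y = x' + (ξ + 1) * y' := by
      apply mul_left_cancel₀ h0
      rw [← he] at h
      linear_combination h
    by_cases hy : y = y'
    · subst hy
      rw [add_right_cancel h1]
    -- A collision with `y ≠ y'` would exhibit `ξ + 1` as the quotient `(x' - x) / (y - y')`.
    · exact absurd ⟨x', hq'.1, x, hq.1, y, hq.2, y', hq'.2, hy, by linear_combination h1⟩ hξ

theorem Finset.sub_mem_three_nsmul_sub {G : Type*} [AddCommGroup G] [DecidableEq G] {W : Finset G}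
    {x₁ x₂ x₃ y₁ y₂ y₃ : G} (h₁ : x₁ ∈ W) (h₂ : x₂ ∈ W) (h₃ : x₃ ∈ W) (k₁ : y₁ ∈ W)
    (k₂ : y₂ ∈ W) (k₃ : y₃ ∈ W) :
    (x₁ + x₂ + x₃) - (y₁ + y₂ + y₃) ∈ 3 • W - 3 • W := by
  have h3 : 3 • W = W + W + W := by rw [succ_nsmul, two_nsmul]
  rw [h3]
  exact Finset.sub_mem_sub (Finset.add_mem_add (Finset.add_mem_add h₁ h₂) h₃)
    (Finset.add_mem_add (Finset.add_mem_add k₁ k₂) k₃)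

theorem Finset.card_mul_card_sq_le_card_image_mul_collisions {α β : Type*} [DecidableEq β]
    (s : Finset α) (f : α → β) :
    #s ^ 2 ≤ #(s.image f) * #{q ∈ s ×ˢ s | f q.1 = f q.2} := by
  classical
  have h1 : #s = ∑ b ∈ s.image f, #{a ∈ s | f a = b} :=
    Finset.card_eq_sum_card_fiberwise (fun a ha => Finset.mem_image_of_mem f ha)
  have h2 : #{q ∈ s ×ˢ s | f q.1 = f q.2} = ∑ b ∈ s.image f, #{a ∈ s | f a = b} ^ 2 := by
    rw [Finset.card_eq_sum_card_fiberwise (f := fun q => f q.1) (t := s.image f)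
      (fun q hq => by
        simp only [Finset.coe_filter, Finset.mem_product, Set.mem_ofPred_eq] at hq
        exact Finset.mem_image_of_mem f hq.1.1)]
    refine Finset.sum_congr rfl fun b _ => ?_
    rw [sq, ← Finset.card_product]
    congr 1
    ext ⟨x, y⟩
    simp only [Finset.mem_filter, Finset.mem_product]
    constructor
    · rintro ⟨⟨⟨hx, hy⟩, h⟩, h'⟩
      exact ⟨⟨hx, h'⟩, hy, h ▸ h'⟩
    · rintro ⟨⟨hx, h⟩, hy, h'⟩
      exact ⟨⟨⟨hx, hy⟩, h.trans h'.symm⟩, h⟩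
  rw [h2]
  nth_rewrite 1 [h1]
  exact sq_sum_le_card_mul_sum_sq

/-- If almost all products of pairs from `B` lie, up to a fixed dilation, in `W`, then the sumset
`3W - 3W` has at least about `|B|²` elements. -/
theorem card_sq_le_card_three_nsmul_sub {p : ℕ} [Fact p.Prime] {B B' W : Finset (ZMod p)}
    {u : ZMod p} (hu : u ≠ 0) (hp : #B ^ 2 ≤ p) (hB' : B' ⊆ B) (hW : W.Nonempty)
    (hcard : 16 * #(B \ B') ≤ #B)
    (hbad : ∀ c ∈ B', 16 * #{x ∈ B | c * x * u ∉ W} ≤ #B) :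
    #B ^ 2 ≤ 32 * #(3 • W - 3 • W) := by
  classical
  have hsd : #(B \ B') + #B' = #B := Finset.card_sdiff_add_card_eq_card hB'
  by_cases hB2 : 2 ≤ #B'
  swap
  · have h1 : #B ≤ 1 := by omega
    obtain ⟨w, hw⟩ := hW
    have h2 : 0 < #(3 • W - 3 • W) :=
      Finset.card_pos.mpr ⟨_, Finset.sub_mem_three_nsmul_sub hw hw hw hw hw hw⟩
    nlinarith
  obtain ⟨a, ha, b, hb, c, hc, d, hd, hcd, hpiv⟩ := exists_pivot B' hB2
    (le_trans (Nat.pow_le_pow_left (Finset.card_le_card hB') 2) hp)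
  let bad : ZMod p → Finset (ZMod p) := fun e => {x ∈ B | e * x * u ∉ W}
  let X : Finset (ZMod p) := B' \ (bad a ∪ bad b ∪ bad c ∪ bad d)
  have hXB : X ⊆ B' := Finset.sdiff_subset
  have hX : ∀ x ∈ X, a * x * u ∈ W ∧ b * x * u ∈ W ∧ c * x * u ∈ W ∧ d * x * u ∈ W := by
    intro x hx
    obtain ⟨hx1, hx2⟩ := Finset.mem_sdiff.mp hx
    have hx3 := hB' hx1
    simp only [bad, Finset.mem_union, Finset.mem_filter, hx3, true_and, not_or, not_not] at hx2
    tauto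
  -- At most `1/16` of `B` is lost to `B \ B'` and `4/16` to the bad sets, leaving at least `11/16`.
  have hXc : #B ≤ 2 * #X := by
    have h1 : #B' ≤ #X + #(bad a ∪ bad b ∪ bad c ∪ bad d) := by
      have := Finset.le_card_sdiff (bad a ∪ bad b ∪ bad c ∪ bad d) B'
      simp only [X]
      omega
    have h2 : #(bad a ∪ bad b ∪ bad c ∪ bad d) ≤ #(bad a) + #(bad b) + #(bad c) + #(bad d) :=
      (Finset.card_union_le _ _).trans (Nat.add_le_add_right ((Finset.card_union_le _ _).trans
        (Nat.add_le_add_right (Finset.card_union_le _ _) _)) _)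
    have h3 := hbad a ha
    have h4 := hbad b hb
    have h5 := hbad c hc
    have h6 := hbad d hd
    simp only [bad] at h1 h2
    omega
  have hXc2 : #B ^ 2 ≤ 4 * #X ^ 2 := by nlinarith
  rcases hpiv with hinj | hcol
  · have h1 : #X ^ 2 ≤ #(3 • W - 3 • W) := by
      rw [sq, ← Finset.card_product]
      refine Finset.card_le_card_of_injOn
        (fun q => u * ((c - d) * q.1 + (a - b) * q.2 + (c - d) * q.2)) ?_ ?_
      · rintro ⟨x, y⟩ hq
        simp only [Finset.coe_product, Set.mem_prod, Finset.mem_coe] at hq ⊢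
        obtain ⟨-, -, h1, h2⟩ := hX x hq.1
        obtain ⟨h3, h4, h5, h6⟩ := hX y hq.2
        have := Finset.sub_mem_three_nsmul_sub h1 h3 h5 h2 h4 h6
        convert this using 1
        ring
      · intro q hq q' hq' h
        refine hinj ?_ ?_ (mul_left_cancel₀ hu h)
        · exact Finset.coe_subset.mpr (Finset.product_subset_product hXB hXB) hq
        · exact Finset.coe_subset.mpr (Finset.product_subset_product hXB hXB) hq'
    omega
  · let f : ZMod p × ZMod p → ZMod p := fun q => (c - d) * q.1 + (a - b) * q.2
    have h1 := Finset.card_mul_card_sq_le_card_image_mul_collisions (X ×ˢ X) f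
    have h2 : #{q ∈ (X ×ˢ X) ×ˢ (X ×ˢ X) | f q.1 = f q.2} ≤ 2 * #B ^ 2 := by
      refine le_trans (le_trans (Finset.card_le_card ?_) hcol)
        (Nat.mul_le_mul_left _ (Nat.pow_le_pow_left (Finset.card_le_card hB') 2))
      exact Finset.filter_subset_filter _ (Finset.product_subset_product
        (Finset.product_subset_product hXB hXB) (Finset.product_subset_product hXB hXB))
    -- Here only two summands occur on each side; an arbitrary `w ∈ W` added to both pads them to
    -- three.
    have h3 : #((X ×ˢ X).image f) ≤ #(3 • W - 3 • W) := by
      obtain ⟨w, hw⟩ := hW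
      refine Finset.card_le_card_of_injOn (fun z => u * z) ?_
        (fun z _ z' _ h => mul_left_cancel₀ hu h)
      intro z hz
      obtain ⟨⟨x, y⟩, hq, rfl⟩ := Finset.mem_image.mp hz
      rw [Finset.mem_product] at hq
      obtain ⟨-, -, h1, h2⟩ := hX x hq.1
      obtain ⟨h3, h4, -, -⟩ := hX y hq.2
      have := Finset.sub_mem_three_nsmul_sub h1 h3 hw h2 h4 hw
      rw [Finset.mem_coe]
      convert this using 1
      simp only [f]
      ring
    rw [Finset.card_product] at h1
    have h4 : (#X * #X) ^ 2 ≤ #(3 • W - 3 • W) * (2 * #B ^ 2) :=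
      h1.trans (Nat.mul_le_mul h3 h2)
    have hpos : 0 < #B ^ 2 := by
      have : 0 < #B := by omega
      positivity
    refine Nat.le_of_mul_le_mul_right ?_ hpos
    calc #B ^ 2 * #B ^ 2 ≤ (4 * #X ^ 2) * (4 * #X ^ 2) := Nat.mul_le_mul hXc2 hXc2
      _ = 16 * (#X * #X) ^ 2 := by ring
      _ ≤ 16 * (#(3 • W - 3 • W) * (2 * #B ^ 2)) := by gcongr
      _ = _ := by ring

/-! ### Popular quotients -/

/-- The number of representations of `s` as a quotient of two elements of `Γ`. -/
def quotientReps {K : Type*} [Mul K] [DecidableEq K] (Γ : Finset K) (s : K) : ℕ :=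
  #{z ∈ Γ | s * z ∈ Γ}

theorem Finset.card_mul_le_card_of_le_card_fiber {α β : Type*} [DecidableEq β] (D : Finset β)
    (T : Finset α) (f : α → β) (k : ℝ) (h : ∀ d ∈ D, k ≤ #{a ∈ T | f a = d}) :
    #D * k ≤ #T := by
  calc #D * k = ∑ _d ∈ D, k := by simp
    _ ≤ ∑ d ∈ D, (#{a ∈ T | f a = d} : ℝ) := Finset.sum_le_sum h
    _ = ((∑ d ∈ D, #{a ∈ T | f a = d} : ℕ) : ℝ) := by push_cast; rfl
    _ = (#{a ∈ T | f a ∈ D} : ℝ) := by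
      congr 1
      rw [Finset.card_eq_sum_card_fiberwise (f := f) (t := D)
        (fun a ha => by simpa using (Finset.mem_filter.mp ha).2)]
      refine Finset.sum_congr rfl fun d hd => ?_
      congr 1
      ext a
      simp only [Finset.mem_filter]
      constructor
      · rintro ⟨ha, rfl⟩
        exact ⟨⟨ha, hd⟩, rfl⟩
      · rintro ⟨⟨ha, -⟩, h⟩
        exact ⟨ha, h⟩
    _ ≤ #T := by exact_mod_cast Finset.card_le_card (Finset.filter_subset _ _)

section Field

variable {K : Type*} [Field K] [DecidableEq K]

/-- The denominator determines a pair with given quotient, so each unpopular quotient accounts for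
fewer than `η` pairs. -/
theorem card_pairs_quotientReps_lt {Γ : Finset K} (h0 : (0 : K) ∉ Γ) {η : ℝ} (hη : 0 ≤ η) :
    (#{q ∈ Γ ×ˢ Γ | (quotientReps Γ (q.1 / q.2) : ℝ) < η} : ℝ) ≤ η * #(Γ / Γ) := by
  set T : Finset (K × K) := {q ∈ Γ ×ˢ Γ | (quotientReps Γ (q.1 / q.2) : ℝ) < η} with hT
  have h1 : #T = ∑ s ∈ Γ / Γ, #{q ∈ T | q.1 / q.2 = s} :=
    Finset.card_eq_sum_card_fiberwise (fun q hq => by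
      have hq' := Finset.mem_product.mp (Finset.mem_filter.mp hq).1
      exact Finset.mem_coe.mpr (Finset.div_mem_div hq'.1 hq'.2))
  rw [h1]
  push_cast
  calc ∑ s ∈ Γ / Γ, (#{q ∈ T | q.1 / q.2 = s} : ℝ) ≤ ∑ _s ∈ Γ / Γ, η := by
        refine Finset.sum_le_sum fun s _ => ?_
        by_cases hs : (quotientReps Γ s : ℝ) < η
        · refine le_trans ?_ hs.le
          rw [quotientReps]
          norm_cast
          refine Finset.card_le_card_of_injOn (fun q => q.2) ?_ ?_
          · rintro ⟨y, z⟩ hq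
            simp only [hT, Finset.coe_filter, Finset.mem_filter, Finset.mem_product,
              Set.mem_ofPred_eq] at hq ⊢
            obtain ⟨⟨⟨hy, hz⟩, -⟩, rfl⟩ := hq
            have hz0 : z ≠ 0 := fun h => h0 (h ▸ hz)
            exact ⟨hz, by rwa [div_mul_cancel₀ _ hz0]⟩
          · rintro ⟨y, z⟩ hq ⟨y', z'⟩ hq' h
            simp only [hT, Finset.coe_filter, Finset.mem_filter, Finset.mem_product,
              Set.mem_ofPred_eq] at hq hq' h
            subst h
            have hz0 : z ≠ 0 := fun h => h0 (h ▸ hq.1.1.2)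
            have := hq.2.trans hq'.2.symm
            rw [div_left_inj' hz0] at this
            rw [this]
        · have : #{q ∈ T | q.1 / q.2 = s} = 0 := by
            rw [Finset.card_eq_zero, Finset.filter_eq_empty_iff]
            rintro q hq rfl
            exact hs (Finset.mem_filter.mp hq).2
          rw [this]
          exact_mod_cast hη
    _ = η * #(Γ / Γ) := by simp [mul_comm]

/-- If `P` contains all `s - s γ` with `γ ∈ Γ` and `s ∈ Γ ∪ Γ / Γ`, then the set of popular
quotients of `Γ` has a small difference set with a large subset of `Γ`. -/
theorem exists_subset_card_sub_popular {Γ P : Finset K} (h0 : (0 : K) ∉ Γ) {lam : ℝ}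
    (hlam : 0 < lam) (hΓ : Γ.Nonempty) (hP : ∀ γ ∈ Γ, ∀ s ∈ Γ ∪ Γ / Γ, s - s * γ ∈ P) :
    ∃ A ⊆ Γ, (#Γ : ℝ) ≤ 2 * #A ∧
      (#(A - {s ∈ Γ / Γ | lam ≤ quotientReps Γ s}) : ℝ) * (lam ^ 2 * #Γ) ≤
        8 * #(Γ / Γ) * #P ^ 3 := by
  set n : ℝ := ((#Γ : ℕ) : ℝ) with hn
  set Q : ℝ := ((#(Γ / Γ) : ℕ) : ℝ) with hQ
  have hn0 : 0 < n := Nat.cast_pos.mpr (Finset.card_pos.mpr hΓ)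
  have hQ0 : 0 < Q := Nat.cast_pos.mpr (Finset.card_pos.mpr (hΓ.div hΓ))
  -- With this `η` there are at most `lam * n / 4` unpopular pairs, so by Markov at most `n / 2`
  -- elements `y` have more than `lam / 2` unpopular partners.
  set η : ℝ := lam * n / (4 * Q) with hη
  have hη0 : 0 < η := by positivity
  set A : Finset K := {y ∈ Γ | (#{z ∈ Γ | (quotientReps Γ (y / z) : ℝ) < η} : ℝ) ≤ lam / 2} with hA
  have hAΓ : A ⊆ Γ := Finset.filter_subset _ _
  set T : Finset (K × K) := {q ∈ Γ ×ˢ Γ | (quotientReps Γ (q.1 / q.2) : ℝ) < η} with hT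
  have hTc : (#T : ℝ) ≤ η * Q := card_pairs_quotientReps_lt h0 hη0.le
  have hAc : (#(Γ \ A) : ℝ) * (lam / 2) ≤ #T := by
    apply Finset.card_mul_le_card_of_le_card_fiber _ _ (fun q : K × K => q.1)
    intro y hy
    obtain ⟨hy1, hy2⟩ := Finset.mem_sdiff.mp hy
    simp only [hA, Finset.mem_filter, hy1, true_and, not_le] at hy2
    refine hy2.le.trans ?_
    norm_cast
    refine Finset.card_le_card_of_injOn (fun z => (y, z)) ?_ (fun z _ z' _ h => (Prod.ext_iff.mp h).2)
    intro z hz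
    simp only [Finset.coe_filter, Set.mem_ofPred_eq, hT, Finset.mem_filter, Finset.mem_product,
      and_true] at hz ⊢
    exact ⟨⟨hy1, hz.1⟩, hz.2⟩
  refine ⟨A, hAΓ, ?_, ?_⟩
  · have h1 : (#(Γ \ A) : ℝ) + #A = n := by
      rw [hn]; exact_mod_cast Finset.card_sdiff_add_card_eq_card hAΓ
    have h2 : (#(Γ \ A) : ℝ) * (lam / 2) ≤ n / 2 * (lam / 2) := by
      refine hAc.trans (hTc.trans (le_of_eq ?_))
      rw [hη]; field_simp; norm_num
    have h3 := le_of_mul_le_mul_right h2 (by positivity)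
    linarith
  · set P2 : Finset K := {d ∈ P - P | η ≤ (#{q ∈ P ×ˢ P | q.1 - q.2 = d} : ℝ)} with hP2
    have hP2c : (#P2 : ℝ) * η ≤ #P ^ 2 := by
      have := Finset.card_mul_le_card_of_le_card_fiber P2 (P ×ˢ P) (fun q => q.1 - q.2) η
        (fun d hd => (Finset.mem_filter.mp hd).2)
      rw [Finset.card_product] at this
      push_cast at this
      rwa [sq]
    have hpop : ∀ y ∈ Γ, ∀ z ∈ Γ, η ≤ (quotientReps Γ (y / z) : ℝ) → y - z ∈ P2 := by
      intro y hy z hz h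
      have hy0 : y ≠ 0 := fun h => h0 (h ▸ hy)
      have hz0 : z ≠ 0 := fun h => h0 (h ▸ hz)
      have hle : quotientReps Γ (y / z) ≤ #{q ∈ P ×ˢ P | q.1 - q.2 = y - z} := by
        -- Each `α ∈ Γ` with `(y / z) α ∈ Γ` gives `y - z = (y - y α) - (z - y α)`, a difference of
        -- two elements of `P`.
        rw [quotientReps]
        refine Finset.card_le_card_of_injOn (fun α => (y - y * α, z - z * (y / z * α))) ?_ ?_
        · intro α hα
          simp only [Finset.coe_filter, Set.mem_ofPred_eq, Finset.mem_product] at hα ⊢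
          refine ⟨⟨hP _ hα.1 _ (Finset.mem_union_left _ hy),
            hP _ hα.2 _ (Finset.mem_union_left _ hz)⟩, ?_⟩
          field_simp; ring
        · intro α _ α' _ h
          have := (Prod.ext_iff.mp h).1
          simp only [sub_right_inj] at this
          exact mul_left_cancel₀ hy0 this
      have hle' : η ≤ (#{q ∈ P ×ˢ P | q.1 - q.2 = y - z} : ℝ) := h.trans (by exact_mod_cast hle)
      refine Finset.mem_filter.mpr ⟨?_, hle'⟩
      have hpos : 0 < #{q ∈ P ×ˢ P | q.1 - q.2 = y - z} := by
        have := hη0.trans_le hle'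
        exact_mod_cast this
      obtain ⟨q, hq⟩ := Finset.card_pos.mp hpos
      simp only [Finset.mem_filter, Finset.mem_product] at hq
      rw [← hq.2]
      exact Finset.sub_mem_sub hq.1.1 hq.1.2
    -- Each `γ` with `s γ ∈ Γ` gives `y - s = (y - s γ) - (s - s γ)`; at least `lam / 2` of them put
    -- the first term in `P2`, and the second always lies in `P`.
    have hmain : (#(A - {s ∈ Γ / Γ | lam ≤ quotientReps Γ s}) : ℝ) * (lam / 2) ≤ #(P ×ˢ P2) := by
      apply Finset.card_mul_le_card_of_le_card_fiber _ _ (fun q : K × K => q.2 - q.1)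
      intro d hd
      obtain ⟨y, hy, s, hs, rfl⟩ := Finset.mem_sub.mp hd
      obtain ⟨hs1, hs2⟩ := Finset.mem_filter.mp hs
      obtain ⟨hy1, hy2⟩ := Finset.mem_filter.mp hy
      have hs0 : s ≠ 0 := by
        obtain ⟨a, ha, b, hb, rfl⟩ := Finset.mem_div.mp hs1
        exact div_ne_zero (fun h => h0 (h ▸ ha)) (fun h => h0 (h ▸ hb))
      -- elements `z = s γ` of `s Γ ∩ Γ`, discarding those with `y / z` unpopular
      set Z : Finset K := {γ ∈ Γ | s * γ ∈ Γ} with hZ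
      set Bad : Finset K := {γ ∈ Z | (quotientReps Γ (y / (s * γ)) : ℝ) < η} with hBad
      have hBadc : (#Bad : ℝ) ≤ lam / 2 := by
        refine le_trans ?_ hy2
        norm_cast
        refine Finset.card_le_card_of_injOn (fun γ => s * γ) ?_
          (fun a _ b _ h => mul_left_cancel₀ hs0 h)
        intro γ hγ
        simp only [hBad, hZ, Finset.coe_filter, Set.mem_ofPred_eq, Finset.mem_filter] at hγ ⊢
        exact ⟨hγ.1.2, hγ.2⟩
      have hZc : (#(Z \ Bad) : ℝ) + #Bad = #Z := by
        exact_mod_cast Finset.card_sdiff_add_card_eq_card (Finset.filter_subset _ _)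
      have hZl : lam ≤ #Z := hs2
      have h1 : lam / 2 ≤ (#(Z \ Bad) : ℝ) := by linarith
      refine h1.trans ?_
      norm_cast
      refine Finset.card_le_card_of_injOn (fun γ => (s - s * γ, y - s * γ)) ?_ ?_
      · intro γ hγ
        rw [Finset.mem_coe, Finset.mem_sdiff] at hγ
        obtain ⟨hγ1, hγ2⟩ := hγ
        obtain ⟨hγ3, hγ4⟩ := Finset.mem_filter.mp hγ1
        have hγ5 : η ≤ (quotientReps Γ (y / (s * γ)) : ℝ) := by
          by_contra h
          exact hγ2 (Finset.mem_filter.mpr ⟨hγ1, not_le.mp h⟩)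
        simp only [Finset.coe_filter, Set.mem_ofPred_eq, Finset.mem_product]
        exact ⟨⟨hP _ hγ3 _ (Finset.mem_union_right _ hs1), hpop _ hy1 _ hγ4 hγ5⟩, by ring⟩
      · intro α _ α' _ h
        have := (Prod.ext_iff.mp h).1
        simp only [sub_right_inj] at this
        exact mul_left_cancel₀ hs0 this
    rw [Finset.card_product] at hmain
    push_cast at hmain
    set D : ℝ := (#(A - {s ∈ Γ / Γ | lam ≤ quotientReps Γ s}) : ℝ)
    have h2 : D * (lam / 2) * η ≤ #P * #P ^ 2 := by
      calc _ ≤ (#P * #P2 : ℝ) * η := by gcongr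
        _ = #P * (#P2 * η) := by ring
        _ ≤ _ := by gcongr
    calc D * (lam ^ 2 * n) = 8 * Q * (D * (lam / 2) * η) := by
          rw [hη]; field_simp; ring
      _ ≤ 8 * Q * (#P * #P ^ 2) := by gcongr
      _ = _ := by ring

theorem sum_card_factors {Γ : Finset K} (h0 : (0 : K) ∉ Γ) :
    ∑ w ∈ Γ * Γ, #{c ∈ Γ | w / c ∈ Γ} = #Γ ^ 2 := by
  have h1 : #(Γ ×ˢ Γ) = ∑ w ∈ Γ * Γ, #{q ∈ Γ ×ˢ Γ | q.1 * q.2 = w} :=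
    Finset.card_eq_sum_card_fiberwise (fun q hq => by
      have hq' := Finset.mem_product.mp hq
      exact Finset.mem_coe.mpr (Finset.mul_mem_mul hq'.1 hq'.2))
  have h2 : ∀ w ∈ Γ * Γ, #{q ∈ Γ ×ˢ Γ | q.1 * q.2 = w} = #{c ∈ Γ | w / c ∈ Γ} := by
    intro w _
    refine Finset.card_bij' (fun q _ => q.1) (fun c _ => (c, w / c)) ?_ ?_ ?_ ?_
    · rintro ⟨x, y⟩ hq
      simp only [Finset.mem_filter, Finset.mem_product] at hq ⊢
      obtain ⟨⟨hx, hy⟩, rfl⟩ := hq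
      have hx0 : x ≠ 0 := fun h => h0 (h ▸ hx)
      exact ⟨hx, by rwa [mul_div_cancel_left₀ _ hx0]⟩
    · intro c hc
      simp only [Finset.mem_filter, Finset.mem_product] at hc ⊢
      have hx0 : c ≠ 0 := fun h => h0 (h ▸ hc.1)
      exact ⟨hc, mul_div_cancel₀ _ hx0⟩
    · rintro ⟨x, y⟩ hq
      simp only [Finset.mem_filter, Finset.mem_product] at hq ⊢
      obtain ⟨⟨hx, hy⟩, rfl⟩ := hq
      have hx0 : x ≠ 0 := fun h => h0 (h ▸ hx)
      rw [mul_div_cancel_left₀ _ hx0]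
    · intro c _
      rfl
  rw [Finset.sum_congr rfl h2, Finset.card_product] at h1
  rw [sq]
  exact h1.symm

/-- For factors `c`, `x` of `w`, the element `c x / w = x / (w / c)` is a quotient of elements of
`Γ`, and also equals `c / (w / x)`. So triples `(w, c, x)` inject into pairs together with a second
representation of their quotient. -/
theorem sum_card_pairs_factors_le {Γ Λ : Finset K} (h0 : (0 : K) ∉ Γ) :
    ∑ w ∈ Γ * Γ, #{q ∈ {c ∈ Γ | w / c ∈ Γ} ×ˢ {c ∈ Γ | w / c ∈ Γ} | q.1 * q.2 * w⁻¹ ∉ Λ} ≤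
      ∑ q ∈ Γ ×ˢ Γ with q.1 / q.2 ∉ Λ, quotientReps Γ (q.1 / q.2) := by
  have hne : ∀ w ∈ Γ * Γ, w ≠ 0 := by
    intro w hw
    obtain ⟨a, ha, b, hb, rfl⟩ := Finset.mem_mul.mp hw
    exact mul_ne_zero (fun h => h0 (h ▸ ha)) (fun h => h0 (h ▸ hb))
  simp only [quotientReps]
  rw [← Finset.card_sigma, ← Finset.card_sigma]
  refine Finset.card_le_card_of_injOn (fun t : (_ : K) × K × K =>
    (⟨(t.2.2, t.1 / t.2.1), t.1 / t.2.2⟩ : (_ : K × K) × K)) ?_ ?_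
  · rintro ⟨w, c, x⟩ ht
    simp only [Finset.coe_sigma, Set.mem_sigma_iff, Finset.mem_coe, Finset.mem_filter,
      Finset.mem_product] at ht ⊢
    obtain ⟨hw, ⟨⟨hc, hc'⟩, hx, hx'⟩, hcx⟩ := ht
    have hw0 := hne w hw
    have hc0 : c ≠ 0 := fun h => h0 (h ▸ hc)
    have hx0 : x ≠ 0 := fun h => h0 (h ▸ hx)
    refine ⟨⟨⟨hx, hc'⟩, ?_⟩, hx', ?_⟩
    · convert hcx using 2
      field_simp
    · convert hc using 1
      field_simp
  · rintro ⟨w, c, x⟩ ht ⟨w', c', x'⟩ ht' h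
    simp only [Finset.coe_sigma, Set.mem_sigma_iff, Finset.mem_coe, Finset.mem_filter,
      Finset.mem_product] at ht ht'
    simp only [Sigma.mk.injEq, Prod.mk.injEq, heq_eq_eq] at h
    obtain ⟨⟨rfl, h1⟩, h2⟩ := h
    have hx0 : x ≠ 0 := fun h => h0 (h ▸ ht.2.1.2.1)
    have hc0 : c ≠ 0 := fun h => h0 (h ▸ ht.2.1.1.1)
    have hc0' : c' ≠ 0 := fun h => h0 (h ▸ ht'.2.1.1.1)
    have hw0 := hne w ht.1
    have hww : w = w' := by rwa [div_left_inj' hx0] at h2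
    subst hww
    have hcc : c = c' := by
      field_simp at h1
      exact h1.symm
    rw [hcc]

/-- There is `w` with many factorizations `w = c c'` in `Γ`, such that for almost all pairs of
factors `c, x` of `w`, the element `c x / w` is a popular quotient of `Γ`. -/
theorem exists_factor_set {Γ : Finset K} (h0 : (0 : K) ∉ Γ) (hΓ : Γ.Nonempty) {Q δ : ℝ}
    (hδ : 0 < δ) (hQ : #(Γ * Γ) ≤ Q) :
    ∃ w ≠ 0, ∃ B ⊆ Γ, B.Nonempty ∧ (#Γ : ℝ) ^ 2 ≤ 2 * Q * #B ∧
      (#{q ∈ B ×ˢ B | q.1 * q.2 * w⁻¹ ∉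
        {s ∈ Γ / Γ | δ * #Γ ^ 2 / Q ≤ quotientReps Γ s}} : ℝ) ≤ 2 * δ * #B ^ 2 := by
  set n : ℝ := ((#Γ : ℕ) : ℝ) with hn
  have hn0 : 0 < n := Nat.cast_pos.mpr (Finset.card_pos.mpr hΓ)
  have hQ0 : 0 < Q := lt_of_lt_of_le (by exact_mod_cast Finset.card_pos.mpr (hΓ.mul hΓ)) hQ
  set lam : ℝ := δ * n ^ 2 / Q with hlam
  have hlam0 : 0 < lam := by positivity
  set Λ : Finset K := {s ∈ Γ / Γ | lam ≤ quotientReps Γ s} with hΛ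
  let B : K → Finset K := fun w => {c ∈ Γ | w / c ∈ Γ}
  let bad : K → Finset (K × K) := fun w => {q ∈ B w ×ˢ B w | q.1 * q.2 * w⁻¹ ∉ Λ}
  have hne : ∀ w ∈ Γ * Γ, w ≠ 0 ∧ (B w).Nonempty := by
    intro w hw
    obtain ⟨a, ha, b, hb, rfl⟩ := Finset.mem_mul.mp hw
    have ha0 : a ≠ 0 := fun h => h0 (h ▸ ha)
    have hb0 : b ≠ 0 := fun h => h0 (h ▸ hb)
    exact ⟨mul_ne_zero ha0 hb0, a, Finset.mem_filter.mpr ⟨ha, by rwa [mul_div_cancel_left₀ _ ha0]⟩⟩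
  have hB1 : ∑ w ∈ Γ * Γ, (#(B w) : ℝ) = n ^ 2 := by
    rw [hn]
    exact_mod_cast sum_card_factors h0
  have hB2 : n ^ 4 / Q ≤ ∑ w ∈ Γ * Γ, (#(B w) : ℝ) ^ 2 := by
    rw [div_le_iff₀ hQ0]
    calc n ^ 4 = (∑ w ∈ Γ * Γ, (#(B w) : ℝ)) ^ 2 := by rw [hB1]; ring
      _ ≤ #(Γ * Γ) * ∑ w ∈ Γ * Γ, (#(B w) : ℝ) ^ 2 := sq_sum_le_card_mul_sum_sq
      _ ≤ Q * ∑ w ∈ Γ * Γ, (#(B w) : ℝ) ^ 2 :=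
        mul_le_mul_of_nonneg_right hQ (Finset.sum_nonneg fun _ _ => sq_nonneg _)
      _ = _ := mul_comm _ _
  have hbad : ∑ w ∈ Γ * Γ, (#(bad w) : ℝ) ≤ lam * n ^ 2 := by
    have h1 : ∑ w ∈ Γ * Γ, #(bad w) ≤
        ∑ q ∈ Γ ×ˢ Γ with q.1 / q.2 ∉ Λ, quotientReps Γ (q.1 / q.2) :=
      sum_card_pairs_factors_le h0
    calc ∑ w ∈ Γ * Γ, (#(bad w) : ℝ) = ((∑ w ∈ Γ * Γ, #(bad w) : ℕ) : ℝ) := by push_cast; rfl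
      _ ≤ ((∑ q ∈ Γ ×ˢ Γ with q.1 / q.2 ∉ Λ, quotientReps Γ (q.1 / q.2) : ℕ) : ℝ) := by
        exact_mod_cast h1
      _ = ∑ q ∈ Γ ×ˢ Γ with q.1 / q.2 ∉ Λ, (quotientReps Γ (q.1 / q.2) : ℝ) := by push_cast; rfl
      _ ≤ ∑ q ∈ Γ ×ˢ Γ with q.1 / q.2 ∉ Λ, lam := by
        refine Finset.sum_le_sum fun q hq => ?_
        simp only [Finset.mem_filter, Finset.mem_product] at hq
        by_contra h
        exact hq.2 (Finset.mem_filter.mpr ⟨Finset.div_mem_div hq.1.1 hq.1.2, (not_le.mp h).le⟩)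
      _ = #{q ∈ Γ ×ˢ Γ | q.1 / q.2 ∉ Λ} * lam := by simp
      _ ≤ #(Γ ×ˢ Γ) * lam := by
        gcongr
        exact Finset.filter_subset _ _
      _ = lam * n ^ 2 := by rw [Finset.card_product, hn]; push_cast; ring
  -- Averaging this combined inequality gives one `w` for which each term on the left is at most
  -- `#(B w) ^ 2`: one term makes `B w` large, the other makes its bad pairs few.
  have hsum : ∑ w ∈ Γ * Γ, ((#(bad w) : ℝ) / (2 * δ) + n ^ 2 / (2 * Q) * #(B w)) ≤
      ∑ w ∈ Γ * Γ, (#(B w) : ℝ) ^ 2 := by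
    rw [Finset.sum_add_distrib, ← Finset.sum_div, ← Finset.mul_sum, hB1]
    calc _ ≤ lam * n ^ 2 / (2 * δ) + n ^ 2 / (2 * Q) * n ^ 2 := by gcongr
      _ = n ^ 4 / Q := by rw [hlam]; field_simp; ring
      _ ≤ _ := hB2
  obtain ⟨w, hw, hle⟩ := Finset.exists_le_of_sum_le (hΓ.mul hΓ) hsum
  have hBpos : 0 < (#(B w) : ℝ) := by exact_mod_cast Finset.card_pos.mpr (hne w hw).2
  refine ⟨w, (hne w hw).1, B w, Finset.filter_subset _ _, (hne w hw).2, ?_, ?_⟩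
  · have h1 : n ^ 2 / (2 * Q) * #(B w) ≤ #(B w) * #(B w) := by
      have : (0 : ℝ) ≤ #(bad w) / (2 * δ) := by positivity
      rw [← sq]
      linarith
    have h2 := le_of_mul_le_mul_right h1 hBpos
    rw [div_le_iff₀ (by positivity)] at h2
    linarith
  · have h1 : (#(bad w) : ℝ) / (2 * δ) ≤ #(B w) ^ 2 := by
      have : (0 : ℝ) ≤ n ^ 2 / (2 * Q) * #(B w) := by positivity
      linarith
    rw [div_le_iff₀ (by positivity)] at h1
    linarith

end Field

/-! ### The sum-product inequality -/

/-- A sum-product type inequality: if `Γ` is nearly closed under multiplication and division, and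
all `s - s γ` lie in `P`, then `P` is large. -/
theorem card_pow_le_of_sub_mul_mem {p : ℕ} [Fact p.Prime] {Γ P : Finset (ZMod p)}
    (h0 : (0 : ZMod p) ∉ Γ) (hΓ : Γ.Nonempty) (hp : #Γ ^ 2 ≤ p) {Q : ℝ} (hQ1 : #(Γ / Γ) ≤ Q)
    (hQ2 : #(Γ * Γ) ≤ Q) (hP : ∀ γ ∈ Γ, ∀ s ∈ Γ ∪ Γ / Γ, s - s * γ ∈ P) :
    (#Γ : ℝ) ^ 39 ≤ 2 ^ 139 * Q ^ 20 * (#P : ℝ) ^ 18 := by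
  classical
  have hn0 : (0 : ℝ) < #Γ := by exact_mod_cast Finset.card_pos.mpr hΓ
  have hQ0 : 0 < Q := lt_of_lt_of_le (by exact_mod_cast Finset.card_pos.mpr (hΓ.mul hΓ)) hQ2
  obtain ⟨w, hw, B, hBΓ, hBne, hBc, hBbad⟩ :=
    -- Here `2 δ = (1 / 16) ^ 2`: by Markov, at most `#B / 16` elements have more than `#B / 16` bad
    -- partners.
    exists_factor_set h0 hΓ (δ := 1 / 512) (by norm_num) hQ2
  set lam : ℝ := 1 / 512 * #Γ ^ 2 / Q with hlam
  have hlam0 : 0 < lam := by positivity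
  obtain ⟨A, hAΓ, hAc, hAΛ⟩ := exists_subset_card_sub_popular h0 hlam0 hΓ hP
  set Λ : Finset (ZMod p) := {s ∈ Γ / Γ | lam ≤ quotientReps Γ s} with hΛ
  have hB0 : 0 < #B := Finset.card_pos.mpr hBne
  have hbad : 256 * #{q ∈ B ×ˢ B | q.1 * q.2 * w⁻¹ ∉ Λ} ≤ #B ^ 2 := by
    have : (256 : ℝ) * #{q ∈ B ×ˢ B | q.1 * q.2 * w⁻¹ ∉ Λ} ≤ #B ^ 2 := by linarith
    exact_mod_cast this
  have hΛne : Λ.Nonempty := by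
    by_contra h
    rw [Finset.not_nonempty_iff_eq_empty] at h
    rw [h] at hbad
    simp only [Finset.notMem_empty, not_false_eq_true, Finset.filter_true,
      Finset.card_product] at hbad
    nlinarith
  let B' : Finset (ZMod p) := {c ∈ B | 16 * #{x ∈ B | c * x * w⁻¹ ∉ Λ} ≤ #B}
  have hB'c : 16 * #(B \ B') ≤ #B := by
    have h1 : (#(B \ B') : ℝ) * (#B / 16) ≤ #{q ∈ B ×ˢ B | q.1 * q.2 * w⁻¹ ∉ Λ} := by
      apply Finset.card_mul_le_card_of_le_card_fiber _ _ (fun q => q.1)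
      intro c hc
      obtain ⟨hc1, hc2⟩ := Finset.mem_sdiff.mp hc
      simp only [B', Finset.mem_filter, hc1, true_and, not_le] at hc2
      have h2 : #{x ∈ B | c * x * w⁻¹ ∉ Λ} ≤
          #{q ∈ {q ∈ B ×ˢ B | q.1 * q.2 * w⁻¹ ∉ Λ} | q.1 = c} := by
        refine Finset.card_le_card_of_injOn (fun x => (c, x)) ?_
          (fun z _ z' _ h => (Prod.ext_iff.mp h).2)
        intro x hx
        simp only [Finset.coe_filter, Set.mem_ofPred_eq, Finset.mem_filter, Finset.mem_product,
          and_true] at hx ⊢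
        exact ⟨⟨hc1, hx.1⟩, hx.2⟩
      have h3 : #B ≤ 16 * #{q ∈ {q ∈ B ×ˢ B | q.1 * q.2 * w⁻¹ ∉ Λ} | q.1 = c} := by omega
      have h4 : (#B : ℝ) ≤ 16 * #{q ∈ {q ∈ B ×ˢ B | q.1 * q.2 * w⁻¹ ∉ Λ} | q.1 = c} := by
        exact_mod_cast h3
      linarith
    have h2 : (256 : ℝ) * #{q ∈ B ×ˢ B | q.1 * q.2 * w⁻¹ ∉ Λ} ≤ #B ^ 2 := by exact_mod_cast hbad
    have h3 : (16 * #(B \ B') : ℝ) * #B ≤ #B * #B := by nlinarith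
    have h4 := le_of_mul_le_mul_right h3 (by exact_mod_cast hB0)
    exact_mod_cast h4
  have hBp : #B ^ 2 ≤ p := (Nat.pow_le_pow_left (Finset.card_le_card hBΓ) 2).trans hp
  have hpiv := card_sq_le_card_three_nsmul_sub (inv_ne_zero hw) hBp (Finset.filter_subset _ B)
    hΛne hB'c (fun c hc => (Finset.mem_filter.mp hc).2)
  have hA0 : (0 : ℝ) < #A := by linarith
  have hAne : A.Nonempty := Finset.card_pos.mp (by exact_mod_cast hA0)
  have hpl : (#(3 • Λ - 3 • Λ) : ℝ) ≤ (#(A - Λ) / #A : ℝ) ^ 6 * #A := by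
    have := Finset.pluennecke_ruzsa_inequality_nsmul_sub_nsmul_sub hAne Λ 3 3
    have h := (NNRat.cast_le (K := ℝ)).mpr this
    push_cast at h
    exact h
  set n : ℝ := (#Γ : ℝ) with hn
  set b : ℝ := (#B : ℝ) with hb
  set P' : ℝ := (#P : ℝ) with hP'
  have hAn : (#A : ℝ) ≤ n := by rw [hn]; exact_mod_cast Finset.card_le_card hAΓ
  -- The factor `2 ^ 22` is `8` from `hAΛ`, `2 ^ 18` from `lam ^ 2`, and `2` from `n ≤ 2 * #A`.
  have hκ : (#(A - Λ) / #A : ℝ) ≤ 2 ^ 22 * Q ^ 3 * P' ^ 3 / n ^ 6 := by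
    rw [div_le_div_iff₀ hA0 (by positivity)]
    have h1 : (#(A - Λ) : ℝ) * (lam ^ 2 * n) ≤ 8 * Q * P' ^ 3 :=
      hAΛ.trans (by gcongr)
    have h2 : (#(A - Λ) : ℝ) * n ^ 5 ≤ 2 ^ 21 * Q ^ 3 * P' ^ 3 := by
      have h3 : (#(A - Λ) : ℝ) * (lam ^ 2 * n) = #(A - Λ) * n ^ 5 / (2 ^ 18 * Q ^ 2) := by
        rw [hlam]; field_simp; norm_num
      rw [h3, div_le_iff₀ (by positivity)] at h1
      linarith
    calc (#(A - Λ) : ℝ) * n ^ 6 = #(A - Λ) * n ^ 5 * n := by ring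
      _ ≤ (2 ^ 21 * Q ^ 3 * P' ^ 3) * (2 * #A) := by gcongr
      _ = _ := by ring
  have h1 : b ^ 2 ≤ 32 * ((2 ^ 22 * Q ^ 3 * P' ^ 3 / n ^ 6) ^ 6 * n) := by
    calc b ^ 2 ≤ 32 * (#(3 • Λ - 3 • Λ) : ℝ) := by rw [hb]; exact_mod_cast hpiv
      _ ≤ 32 * ((#(A - Λ) / #A : ℝ) ^ 6 * #A) := by gcongr
      _ ≤ _ := by gcongr
  have h2 : n ^ 4 ≤ 4 * Q ^ 2 * b ^ 2 := by
    calc n ^ 4 = (n ^ 2) ^ 2 := by ring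
      _ ≤ (2 * Q * b) ^ 2 := by gcongr
      _ = _ := by ring
  have h3 : n ^ 4 * n ^ 35 ≤ 2 ^ 139 * Q ^ 20 * P' ^ 18 := by
    calc n ^ 4 * n ^ 35 ≤ (4 * Q ^ 2 * (32 * ((2 ^ 22 * Q ^ 3 * P' ^ 3 / n ^ 6) ^ 6 * n))) * n ^ 35 := by
          gcongr
          exact h2.trans (by gcongr)
      _ = _ := by
        field_simp
        norm_num
  calc n ^ 39 = n ^ 4 * n ^ 35 := by ring
    _ ≤ _ := h3

/-! ### Moments of exponential sums and additive energy -/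

section Fourier

variable {p : ℕ} [Fact p.Prime]

theorem ZMod.sum_norm_sq_sum_mul_stdAddChar (φ : ZMod p → ℂ) :
    ∑ t : ZMod p, ‖∑ d, φ d * ZMod.stdAddChar (t * d)‖ ^ 2 = p * ∑ d, ‖φ d‖ ^ 2 := by
  have key : ∀ t : ZMod p, ((‖∑ d, φ d * ZMod.stdAddChar (t * d)‖ ^ 2 : ℝ) : ℂ) =
      ∑ d, ∑ d', φ d * (starRingEnd ℂ) (φ d') * ZMod.stdAddChar (t * (d - d')) := by
    intro t
    push_cast
    rw [← Complex.mul_conj', map_sum, Finset.sum_mul_sum]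
    refine Finset.sum_congr rfl fun d _ => Finset.sum_congr rfl fun d' _ => ?_
    rw [map_mul (starRingEnd ℂ), mul_sub, sub_eq_add_neg, AddChar.map_add_eq_mul, AddChar.map_neg_eq_conj]
    ring
  have h : ((∑ t : ZMod p, ‖∑ d, φ d * ZMod.stdAddChar (t * d)‖ ^ 2 : ℝ) : ℂ) =
      ((p * ∑ d, ‖φ d‖ ^ 2 : ℝ) : ℂ) := by
    rw [Complex.ofReal_sum, Finset.sum_congr rfl fun t _ => key t, Finset.sum_comm]
    push_cast
    rw [Finset.mul_sum]
    refine Finset.sum_congr rfl fun d _ => ?_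
    rw [Finset.sum_comm]
    simp_rw [← Finset.mul_sum, AddChar.sum_mulShift _ (ZMod.isPrimitive_stdAddChar p), sub_eq_zero,
      ZMod.card]
    rw [Finset.sum_eq_single d]
    · rw [if_pos rfl, Complex.mul_conj']
      ring
    · intro b _ hb
      rw [if_neg (Ne.symm hb)]
      simp
    · simp
  exact_mod_cast h

variable {ι : Type*}

/-- The exponential sum over the family `f i`, `i ∈ I`. -/
noncomputable def familyExpSum (I : Finset ι) (f : ι → ZMod p) (t : ZMod p) : ℂ :=
  ∑ i ∈ I, ZMod.stdAddChar (t * f i)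

/-- The number of representations of `d` as a difference of members of the family `f i`, `i ∈ I`. -/
def differenceReps (I : Finset ι) (f : ι → ZMod p) (d : ZMod p) : ℕ :=
  #{q ∈ I ×ˢ I | f q.1 - f q.2 = d}

/-- The additive energy of the family `f i`, `i ∈ I`. -/
def familyEnergy (I : Finset ι) (f : ι → ZMod p) : ℕ :=
  ∑ d, differenceReps I f d ^ 2

theorem sum_norm_sq_familyExpSum {I : Finset ι} {f : ι → ZMod p} (hf : Set.InjOn f I) :
    ∑ t, ‖familyExpSum I f t‖ ^ 2 = p * #I := by
  classical
  have h1 : ∀ t, familyExpSum I f t =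
      ∑ d, (if d ∈ I.image f then (1 : ℂ) else 0) * ZMod.stdAddChar (t * d) := by
    intro t
    simp only [ite_mul, one_mul, zero_mul, Finset.sum_ite_mem, Finset.univ_inter]
    rw [Finset.sum_image hf, familyExpSum]
  rw [Finset.sum_congr rfl fun t _ => by rw [h1 t], ZMod.sum_norm_sq_sum_mul_stdAddChar]
  congr 1
  have h2 : ∀ d, ‖(if d ∈ I.image f then (1 : ℂ) else 0)‖ ^ 2 =
      if d ∈ I.image f then (1 : ℝ) else 0 := by
    intro d
    split_ifs <;> simp
  rw [Finset.sum_congr rfl fun d _ => h2 d]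
  simp only [Finset.sum_ite_mem, Finset.univ_inter]
  simp [Finset.card_image_of_injOn hf]

theorem sum_norm_pow_four_familyExpSum (I : Finset ι) (f : ι → ZMod p) :
    ∑ t, ‖familyExpSum I f t‖ ^ 4 = p * familyEnergy I f := by
  classical
  have h1 : ∀ t, ((‖familyExpSum I f t‖ ^ 2 : ℝ) : ℂ) =
      ∑ d, (differenceReps I f d : ℂ) * ZMod.stdAddChar (t * d) := by
    intro t
    push_cast
    rw [← Complex.mul_conj', familyExpSum, map_sum, Finset.sum_mul_sum, ← Finset.sum_product']
    rw [← Finset.sum_fiberwise (I ×ˢ I) (fun q => f q.1 - f q.2)]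
    refine Finset.sum_congr rfl fun d _ => ?_
    rw [differenceReps, ← nsmul_eq_mul, ← Finset.sum_const]
    refine Finset.sum_congr rfl fun q hq => ?_
    rw [← (Finset.mem_filter.mp hq).2, mul_sub, sub_eq_add_neg, AddChar.map_add_eq_mul,
      AddChar.map_neg_eq_conj]
  have h2 : ∀ t, ‖familyExpSum I f t‖ ^ 4 =
      ‖∑ d, (differenceReps I f d : ℂ) * ZMod.stdAddChar (t * d)‖ ^ 2 := by
    intro t
    rw [← h1 t, Complex.norm_real, Real.norm_eq_abs, sq_abs]
    ring
  rw [Finset.sum_congr rfl fun t _ => h2 t, ZMod.sum_norm_sq_sum_mul_stdAddChar, familyEnergy]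
  congr 1
  push_cast
  refine Finset.sum_congr rfl fun d _ => ?_
  rw [Complex.norm_natCast]

/-- Lower bound for the `L¹`-norm of an exponential sum in terms of the additive energy. -/
theorem card_pow_three_le_sum_norm_sq_mul_energy {I : Finset ι} {f : ι → ZMod p}
    (hf : Set.InjOn f I) :
    (p * #I : ℝ) ^ 3 ≤ (∑ t, ‖familyExpSum I f t‖) ^ 2 * (p * familyEnergy I f) := by
  set F := familyExpSum I f
  rw [← sum_norm_sq_familyExpSum hf, ← sum_norm_pow_four_familyExpSum I f]
  set S1 := ∑ t, ‖F t‖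
  set S2 := ∑ t, ‖F t‖ ^ 2
  set S3 := ∑ t, ‖F t‖ ^ 3
  set S4 := ∑ t, ‖F t‖ ^ 4
  -- Two applications of Cauchy–Schwarz eliminate the third moment and give `S2 ^ 3 ≤ S1 ^ 2 * S4`.
  have h1 : S2 ^ 2 ≤ S1 * S3 :=
    Finset.sum_sq_le_sum_mul_sum_of_sq_le_mul _ (fun _ _ => norm_nonneg _)
      (fun _ _ => by positivity) (fun _ _ => le_of_eq (by ring))
  have h2 : S3 ^ 2 ≤ S2 * S4 :=
    Finset.sum_sq_le_sum_mul_sum_of_sq_le_mul _ (fun _ _ => by positivity)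
      (fun _ _ => by positivity) (fun _ _ => le_of_eq (by ring))
  have hS1 : 0 ≤ S1 := Finset.sum_nonneg fun _ _ => norm_nonneg _
  have hS2 : 0 ≤ S2 := Finset.sum_nonneg fun _ _ => by positivity
  have hS3 : 0 ≤ S3 := Finset.sum_nonneg fun _ _ => by positivity
  have hS4 : 0 ≤ S4 := Finset.sum_nonneg fun _ _ => by positivity
  rcases hS2.eq_or_lt with h | h
  · rw [← h, zero_pow three_ne_zero]
    exact mul_nonneg (sq_nonneg _) hS4
  · refine le_of_mul_le_mul_left ?_ h
    calc S2 * S2 ^ 3 = (S2 ^ 2) ^ 2 := by ring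
      _ ≤ (S1 * S3) ^ 2 := by gcongr
      _ = S1 ^ 2 * S3 ^ 2 := by ring
      _ ≤ S1 ^ 2 * (S2 * S4) := by gcongr
      _ = _ := by ring

theorem familyExpSum_range_mul (f : ℕ → ZMod p) (k M : ℕ) (t : ZMod p) :
    familyExpSum (range (k * M)) f t =
      ∑ j ∈ range k, familyExpSum (range M) (fun n => f (j * M + n)) t := by
  induction k with
  | zero => simp [familyExpSum]
  | succ k ih =>
    rw [Finset.sum_range_succ, ← ih, Nat.succ_mul, familyExpSum, Finset.sum_range_add]
    rfl

/-- The energy of `k M` consecutive powers is controlled by that of `M` consecutive powers. -/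
theorem familyEnergy_zpow_range_mul_le {g : ZMod p} (hg : g ≠ 0) (k M : ℕ) (a : ℤ) :
    familyEnergy (range (k * M)) (fun n => g ^ ((n : ℤ) + a)) ≤
      k ^ 4 * familyEnergy (range M) (fun n => g ^ n) := by
  rcases Nat.eq_zero_or_pos k with rfl | hk
  · simp [familyEnergy, differenceReps]
  have hp0 : (0 : ℝ) < p := by exact_mod_cast (Fact.out : p.Prime).pos
  -- Each block is a dilate of the first `M` powers, and dilation merely permutes the frequencies
  -- `t`.
  have hblock : ∀ j : ℕ, ∑ t, ‖familyExpSum (range M)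
      (fun n => g ^ (((j * M + n : ℕ) : ℤ) + a)) t‖ ^ 4 =
      p * familyEnergy (range M) (fun n => g ^ n) := by
    intro j
    rw [← sum_norm_pow_four_familyExpSum]
    have hu : g ^ (((j * M : ℕ) : ℤ) + a) ≠ 0 := zpow_ne_zero _ hg
    refine Fintype.sum_equiv (Equiv.mulRight₀ _ hu) _ _ fun t => ?_
    congr 2
    simp only [familyExpSum]
    refine Finset.sum_congr rfl fun n _ => ?_
    congr 1
    change _ = t * g ^ (((j * M : ℕ) : ℤ) + a) * g ^ n
    rw [mul_assoc, ← zpow_natCast g n, ← zpow_add₀ hg]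
    congr 2
    push_cast
    ring
  -- The power mean inequality costs `k ^ 3`; summing over the `k` blocks supplies the last factor
  -- `k`.
  have h1 : ∀ t, ‖familyExpSum (range (k * M)) (fun n => g ^ ((n : ℤ) + a)) t‖ ^ 4 ≤
      k ^ 3 * ∑ j ∈ range k,
        ‖familyExpSum (range M) (fun n => g ^ (((j * M + n : ℕ) : ℤ) + a)) t‖ ^ 4 := by
    intro t
    rw [familyExpSum_range_mul]
    have h2 := pow_sum_div_card_le_sum_pow (s := range k) (f := fun j => ‖familyExpSum (range M)
      (fun n => g ^ (((j * M + n : ℕ) : ℤ) + a)) t‖) (fun _ _ => norm_nonneg _) 3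
    rw [Finset.card_range, div_le_iff₀ (by positivity), mul_comm] at h2
    exact (pow_le_pow_left₀ (norm_nonneg _) (norm_sum_le _ _) 4).trans h2
  have h3 : (p : ℝ) * familyEnergy (range (k * M)) (fun n => g ^ ((n : ℤ) + a)) ≤
      p * (k ^ 4 * familyEnergy (range M) (fun n => g ^ n) : ℕ) := by
    rw [← sum_norm_pow_four_familyExpSum]
    refine (Finset.sum_le_sum fun t _ => h1 t).trans (le_of_eq ?_)
    rw [← Finset.mul_sum, Finset.sum_comm, Finset.sum_congr rfl fun j _ => hblock j]
    simp
    ring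
  exact_mod_cast le_of_mul_le_mul_left h3 hp0

/-- Dyadic pigeonholing: some difference level carries a large share of the energy. -/
theorem exists_popular_difference_level {I : Finset ι} {f : ι → ZMod p} (hI : I.Nonempty)
    (hf : Set.InjOn f I) :
    ∃ τ : ℕ, 0 < τ ∧ τ ≤ #I ∧ ∃ b ∈ I, familyEnergy I f ≤
      2 * τ * (Nat.log 2 #I + 1) * #I * #{i ∈ I | τ ≤ differenceReps I f (f b - f i)} := by
  classical
  set r := differenceReps I f with hr
  set L := Nat.log 2 #I + 1 with hL
  have hI0 : #I ≠ 0 := (Finset.card_pos.mpr hI).ne'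
  have hrI : ∀ d, r d ≤ #I := by
    intro d
    refine Finset.card_le_card_of_injOn (fun q => q.1) ?_ ?_
    · intro q hq
      exact (Finset.mem_product.mp (Finset.mem_filter.mp hq).1).1
    · rintro ⟨i, j⟩ hq ⟨i', j'⟩ hq' h
      simp only [Finset.coe_filter, Finset.mem_product, Set.mem_ofPred_eq] at hq hq' h
      subst h
      have := hq.2.trans hq'.2.symm
      rw [sub_right_inj] at this
      rw [hf hq.1.2 hq'.1.2 this]
  have hE : familyEnergy I f = ∑ q ∈ I ×ˢ I, r (f q.1 - f q.2) := by
    rw [← Finset.sum_fiberwise (I ×ˢ I) (fun q => f q.1 - f q.2), familyEnergy]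
    refine Finset.sum_congr rfl fun d _ => ?_
    rw [Finset.sum_congr rfl (g := fun _ => r d)
      (fun q hq => by rw [(Finset.mem_filter.mp hq).2]), Finset.sum_const, smul_eq_mul, sq]
    rfl
  have hlev : ∀ m, m ≤ #I → m ≤ ∑ j ∈ range L, if 2 ^ j ≤ m then 2 ^ (j + 1) else 0 := by
    intro m hm
    rcases Nat.eq_zero_or_pos m with rfl | hm0
    · simp
    have h1 : Nat.log 2 m ∈ range L := by
      rw [Finset.mem_range, hL]
      exact Nat.lt_succ_of_le (Nat.log_mono_right hm)
    refine le_trans ?_ (Finset.single_le_sum (fun _ _ => Nat.zero_le _) h1)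
    rw [if_pos (Nat.pow_log_le_self 2 hm0.ne')]
    exact (Nat.lt_pow_succ_log_self one_lt_two m).le
  have hsum : familyEnergy I f ≤ ∑ x ∈ range L ×ˢ I, 2 ^ (x.1 + 1) *
      #{i ∈ I | 2 ^ x.1 ≤ r (f x.2 - f i)} := by
    rw [hE]
    refine (Finset.sum_le_sum fun q _ => hlev _ (hrI _)).trans (le_of_eq ?_)
    rw [Finset.sum_comm, Finset.sum_product]
    refine Finset.sum_congr rfl fun j _ => ?_
    rw [Finset.sum_product]
    refine Finset.sum_congr rfl fun b _ => ?_
    rw [← Finset.sum_filter, Finset.sum_const, smul_eq_mul, mul_comm]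
  -- Average over the `L * #I` pairs of a dyadic level and a base point.
  have hsum2 : ∑ _x ∈ range L ×ˢ I, familyEnergy I f ≤ ∑ x ∈ range L ×ˢ I, L * #I *
      (2 ^ (x.1 + 1) * #{i ∈ I | 2 ^ x.1 ≤ r (f x.2 - f i)}) := by
    rw [← Finset.mul_sum, Finset.sum_const, Finset.card_product, Finset.card_range, smul_eq_mul]
    exact Nat.mul_le_mul_left _ hsum
  obtain ⟨⟨j, b⟩, hx, hle⟩ := Finset.exists_le_of_sum_le
    (Finset.Nonempty.product (by rw [Finset.nonempty_range_iff]; omega) hI) hsum2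
  obtain ⟨hj, hb⟩ := Finset.mem_product.mp hx
  refine ⟨2 ^ j, by positivity, ?_, b, hb, hle.trans (le_of_eq (by ring))⟩
  rw [Finset.mem_range, hL] at hj
  exact (Nat.pow_le_pow_right two_pos (Nat.lt_succ_iff.mp hj)).trans (Nat.pow_log_le_self 2 hI0)

end Fourier

/-! ### Energy of consecutive powers -/

-- Final bookkeeping: `e` is the energy, `t` the level, `n = #Γ`, `k = #P`, `l` the logarithmic
-- factor. Of the `t ^ 39` arising from `e ^ 39`, `t ^ 36` pairs with `k ^ 18` and costs `e ^ 18`,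
-- while `t ^ 3 ≤ m ^ 3`; this leaves `e ^ 21` and `m ^ (39 + 20 + 3)`.
set_option maxRecDepth 4000 in
theorem pow_le_of_popular_level_bounds {e l m n t k : ℝ} (he : 0 ≤ e) (hl : 0 ≤ l) (hk : 0 ≤ k)
    (ht : 0 < t) (htm : t ≤ m) (hen : e ≤ 2 * t * l * m * n) (hke : k * t ^ 2 ≤ 6 ^ 4 * e)
    (hnk : n ^ 39 ≤ 2 ^ 139 * (4 * m) ^ 20 * k ^ 18) :
    e ^ 21 ≤ 2 ^ 218 * 6 ^ 72 * l ^ 39 * m ^ 62 := by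
  have hm : 0 < m := ht.trans_le htm
  rcases he.eq_or_lt with rfl | he'
  · rw [zero_pow (by norm_num)]
    positivity
  have h1 : e ^ 39 ≤ (2 * t * l * m) ^ 39 * n ^ 39 := by
    rw [← mul_pow]
    exact pow_le_pow_left₀ he hen 39
  have h2 : (k * t ^ 2) ^ 18 ≤ 6 ^ 72 * e ^ 18 := by
    refine (pow_le_pow_left₀ (by positivity) hke 18).trans (le_of_eq ?_)
    rw [mul_pow, ← pow_mul]
  have h3 : t ^ 3 ≤ m ^ 3 := pow_le_pow_left₀ ht.le htm 3
  have h4 : e ^ 39 * t ^ 36 ≤ 2 ^ 218 * l ^ 39 * m ^ 59 * t ^ 36 * (t ^ 3 * (k * t ^ 2) ^ 18) := by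
    calc e ^ 39 * t ^ 36 ≤ (2 * t * l * m) ^ 39 * n ^ 39 * t ^ 36 := by gcongr
      _ ≤ (2 * t * l * m) ^ 39 * (2 ^ 139 * (4 * m) ^ 20 * k ^ 18) * t ^ 36 := by gcongr
      _ = _ := by ring
  have h5 : t ^ 3 * (k * t ^ 2) ^ 18 ≤ m ^ 3 * (6 ^ 72 * e ^ 18) := by gcongr
  refine le_of_mul_le_mul_right ?_ (by positivity : 0 < e ^ 18 * t ^ 36)
  calc e ^ 21 * (e ^ 18 * t ^ 36) = e ^ 39 * t ^ 36 := by ring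
    _ ≤ _ := h4
    _ ≤ 2 ^ 218 * l ^ 39 * m ^ 59 * t ^ 36 * (m ^ 3 * (6 ^ 72 * e ^ 18)) := by gcongr
    _ = _ := by ring

/-- Additive energy bound for `M ≤ √p` consecutive powers of an element of `ZMod p`. -/
theorem familyEnergy_powers_pow_le {p : ℕ} [Fact p.Prime] {g : ZMod p} (hg : g ≠ 0) {M : ℕ}
    (hM : 1 ≤ M) (hMp : M ^ 2 ≤ p) (hinj : Set.InjOn (fun n : ℕ => g ^ n) (range M)) :
    (familyEnergy (range M) (fun n : ℕ => g ^ n) : ℝ) ^ 21 ≤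
      2 ^ 218 * 6 ^ 72 * (Nat.log 2 M + 1 : ℕ) ^ 39 * (M : ℝ) ^ 62 := by
  classical
  obtain ⟨τ, hτ, hτM, b, hb, hE⟩ :=
    exists_popular_difference_level (Finset.nonempty_range_iff.mpr (by omega)) hinj
  rw [Finset.card_range] at hτM hE
  set E := familyEnergy (range M) (fun n : ℕ => g ^ n) with hEdef
  set L := Nat.log 2 M + 1 with hL
  set r := differenceReps (range M) (fun n : ℕ => g ^ n) with hr
  set J : Finset ℕ := {i ∈ range M | τ ≤ r (g ^ b - g ^ i)} with hJ
  set Γ : Finset (ZMod p) := J.image (fun i : ℕ => g ^ ((i : ℤ) - (b : ℤ))) with hΓ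
  have hJM : J ⊆ range M := Finset.filter_subset _ _
  have hbM : b < M := Finset.mem_range.mp hb
  have hΓJ : #Γ = #J := by
    refine Finset.card_image_of_injOn fun i hi j hj h => hinj (hJM hi) (hJM hj) ?_
    simp only [zpow_sub₀ hg, zpow_natCast] at h
    exact (div_left_inj' (pow_ne_zero _ hg)).mp h
  rcases J.eq_empty_or_nonempty with hJ0 | hJne
  · rw [hJ0, Finset.card_empty, mul_zero, Nat.le_zero] at hE
    rw [hE]
    simp only [Nat.cast_zero, ne_eq, OfNat.ofNat_ne_zero, not_false_eq_true, zero_pow]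
    positivity
  -- The exponents `k - b + u` below, with `|k| < 2 M` and `0 ≤ b, u < M`, lie strictly between `-3
  -- M` and `3 M`; this window holds them all.
  set f : ℕ → ZMod p := fun n => g ^ ((n : ℤ) + (-3 * M)) with hf
  set R := differenceReps (range (6 * M)) f with hR
  set P : Finset (ZMod p) := {d | τ ≤ R d} with hP
  have hPc : #P * τ ^ 2 ≤ 6 ^ 4 * E := by
    refine le_trans ?_ (familyEnergy_zpow_range_mul_le hg 6 M (-3 * M))
    calc #P * τ ^ 2 = ∑ _d ∈ P, τ ^ 2 := by simp
      _ ≤ ∑ d ∈ P, R d ^ 2 :=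
        Finset.sum_le_sum fun d hd => Nat.pow_le_pow_left (Finset.mem_filter.mp hd).2 2
      _ ≤ ∑ d, R d ^ 2 := Finset.sum_le_sum_of_subset (Finset.subset_univ _)
  -- all elements of `Γ`, `Γ / Γ` and `Γ * Γ` are `g ^ k` with `|k| < 2 M`
  have hΓmem : ∀ γ ∈ Γ, ∃ k : ℤ, -M < k ∧ k < M ∧ γ = g ^ k := by
    intro γ hγ
    obtain ⟨i, hi, rfl⟩ := Finset.mem_image.mp hγ
    have := Finset.mem_range.mp (hJM hi)
    exact ⟨(i : ℤ) - b, by omega, by omega, rfl⟩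
  have hdiv : ∀ s ∈ Γ / Γ, ∃ k : ℤ, -(2 * M) < k ∧ k < 2 * M ∧ s = g ^ k := by
    intro s hs
    obtain ⟨x, hx, y, hy, rfl⟩ := Finset.mem_div.mp hs
    obtain ⟨k, hk1, hk2, rfl⟩ := hΓmem x hx
    obtain ⟨l, hl1, hl2, rfl⟩ := hΓmem y hy
    exact ⟨k - l, by omega, by omega, (zpow_sub₀ hg k l).symm⟩
  have hmul : ∀ s ∈ Γ * Γ, ∃ k : ℤ, -(2 * M) < k ∧ k < 2 * M ∧ s = g ^ k := by
    intro s hs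
    obtain ⟨x, hx, y, hy, rfl⟩ := Finset.mem_mul.mp hs
    obtain ⟨k, hk1, hk2, rfl⟩ := hΓmem x hx
    obtain ⟨l, hl1, hl2, rfl⟩ := hΓmem y hy
    exact ⟨k + l, by omega, by omega, (zpow_add₀ hg k l).symm⟩
  have hcard : ∀ S : Finset (ZMod p), (∀ s ∈ S, ∃ k : ℤ, -(2 * M) < k ∧ k < 2 * M ∧ s = g ^ k) →
      (#S : ℝ) ≤ ((4 * M : ℕ) : ℝ) := by
    intro S hS
    have h1 : S ⊆ (Finset.Ioo (-(2 * M : ℤ)) (2 * M)).image (fun k : ℤ => g ^ k) := by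
      intro s hs
      obtain ⟨k, hk1, hk2, rfl⟩ := hS s hs
      exact Finset.mem_image_of_mem _ (Finset.mem_Ioo.mpr ⟨hk1, hk2⟩)
    have h2 := (Finset.card_le_card h1).trans Finset.card_image_le
    rw [Int.card_Ioo] at h2
    have h3 : #S ≤ 4 * M := by omega
    exact_mod_cast h3
  have h0 : (0 : ZMod p) ∉ Γ := by
    intro h
    obtain ⟨k, -, -, hk⟩ := hΓmem 0 h
    exact zpow_ne_zero k hg hk.symm
  have hPmem : ∀ γ ∈ Γ, ∀ s ∈ Γ ∪ Γ / Γ, s - s * γ ∈ P := by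
    intro γ hγ s hs
    obtain ⟨k, hk1, hk2, rfl⟩ : ∃ k : ℤ, -(2 * M) < k ∧ k < 2 * M ∧ s = g ^ k := by
      rcases Finset.mem_union.mp hs with h | h
      · obtain ⟨k, hk1, hk2, hk⟩ := hΓmem s h
        exact ⟨k, by omega, by omega, hk⟩
      · exact hdiv s h
    obtain ⟨i, hi, rfl⟩ := Finset.mem_image.mp hγ
    obtain ⟨hiM, hir⟩ := Finset.mem_filter.mp hi
    refine Finset.mem_filter.mpr ⟨Finset.mem_univ _, hir.trans ?_⟩
    have hshift : ∀ u : ℕ, u < M → f (k - b + u + 3 * M).toNat = g ^ (k - b) * g ^ u := by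
      intro u hu
      rw [hf, ← zpow_natCast g u, ← zpow_add₀ hg]
      simp only
      congr 1
      omega
    -- As `s - s γ = g ^ (k - b) * (g ^ b - g ^ i)`, each representation of `g ^ b - g ^ i` shifts
    -- to one of `s - s γ`.
    refine Finset.card_le_card_of_injOn
      (fun q : ℕ × ℕ => ((k - b + q.1 + 3 * M).toNat, (k - b + q.2 + 3 * M).toNat)) ?_ ?_
    · rintro ⟨u, v⟩ hq
      simp only [Finset.coe_filter, Finset.mem_product, Finset.mem_range,
        Set.mem_ofPred_eq] at hq ⊢
      obtain ⟨⟨hu, hv⟩, huv⟩ := hq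
      refine ⟨⟨by omega, by omega⟩, ?_⟩
      rw [hshift u hu, hshift v hv, ← mul_sub, huv, mul_sub, ← zpow_natCast g b,
        ← zpow_natCast g i, ← zpow_add₀ hg, ← zpow_add₀ hg, ← zpow_add₀ hg]
      congr 2 <;> ring
    · rintro ⟨u, v⟩ hq ⟨u', v'⟩ hq' h
      simp only [Prod.mk.injEq] at h ⊢
      omega
  have hΓp : #Γ ^ 2 ≤ p := by
    refine le_trans (Nat.pow_le_pow_left ?_ 2) hMp
    rw [hΓJ]
    exact (Finset.card_le_card hJM).trans (Finset.card_range M).le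
  have hmain := card_pow_le_of_sub_mul_mem h0 (hJne.image _) hΓp (hcard _ hdiv) (hcard _ hmul) hPmem
  rw [hΓJ] at hmain
  have hE' : (E : ℝ) ≤ 2 * τ * L * M * #J := by exact_mod_cast hE
  have hPc' : (#P : ℝ) * τ ^ 2 ≤ 6 ^ 4 * E := by exact_mod_cast hPc
  have hτM' : (τ : ℝ) ≤ M := by exact_mod_cast hτM
  have hτ' : (0 : ℝ) < τ := by exact_mod_cast hτ
  push_cast at hmain
  exact pow_le_of_popular_level_bounds (Nat.cast_nonneg _) (Nat.cast_nonneg _) (Nat.cast_nonneg _)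
    hτ' hτM' hE' hPc' hmain

/-! ### The lower bound for the L¹-norm -/

/-- Starting the exponents at `0` instead of `1` removes a factor `g`, which the substitution `t ↦ t
* g` absorbs. -/
theorem powerSumL1Norm_eq {p : ℕ} [Fact p.Prime] {g : ℤ} (hg : (g : ZMod p) ≠ 0) (N : ℝ) :
    powerSumL1Norm p g N =
      (1 / (p : ℝ)) * ∑ t, ‖familyExpSum (range ⌊N⌋₊) (fun n : ℕ => (g : ZMod p) ^ n) t‖ := by
  have h1 : ∀ x : ℕ, ∑ n ∈ Finset.Icc 1 ⌊N⌋₊,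
      Complex.exp (2 * (Real.pi : ℂ) * Complex.I * ((x : ℂ) / (p : ℂ)) * (g : ℂ) ^ n) =
      familyExpSum (range ⌊N⌋₊) (fun n : ℕ => (g : ZMod p) ^ n) ((x : ZMod p) * g) := by
    intro x
    rw [familyExpSum, ← Finset.Ico_succ_right_eq_Icc, Finset.sum_Ico_eq_sum_range]
    refine Finset.sum_congr (by simp) fun n _ => ?_
    have h2 : ((x : ZMod p) * g * (g : ZMod p) ^ n) = ((x * g ^ (1 + n) : ℤ) : ZMod p) := by
      push_cast
      ring
    rw [h2, ZMod.stdAddChar_coe]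
    congr 1
    push_cast
    ring
  rw [powerSumL1Norm]
  congr 1
  rw [← Fintype.sum_equiv (Equiv.mulRight₀ _ hg)
    (fun t => ‖familyExpSum (range ⌊N⌋₊) (fun n : ℕ => (g : ZMod p) ^ n) (t * g)‖) _ fun t => rfl]
  refine Finset.sum_nbij' (fun x : ℕ => (x : ZMod p)) ZMod.val (fun _ _ => Finset.mem_univ _)
    (fun t _ => Finset.mem_range.mpr (ZMod.val_lt t))
    (fun x hx => ZMod.val_cast_of_lt (Finset.mem_range.mp hx))
    (fun t _ => ZMod.natCast_zmod_val t) (fun x _ => by rw [h1 x])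

/-- The exponent `1 / 312` is chosen so that `39 / 312 = 1 / 8`. Giving up `M ^ (1 / 8)` for the
logarithms turns the exponent `1 / 42` into `(7 / 8) / 42 = 1 / 48`. -/
theorem natLog_two_add_one_pow_le {M : ℕ} (hM : 1 ≤ M) :
    ((Nat.log 2 M + 1 : ℕ) : ℝ) ^ 39 ≤ 625 ^ 39 * (M : ℝ) ^ ((1 : ℝ) / 8) := by
  have hM1 : (1 : ℝ) ≤ M := by exact_mod_cast hM
  have h1 : (Nat.log 2 M : ℝ) ≤ 624 * (M : ℝ) ^ ((1 : ℝ) / 312) := by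
    have h2 : (Nat.log 2 M : ℝ) ≤ Real.logb 2 M := by exact_mod_cast Real.natLog_le_logb M 2
    refine h2.trans ?_
    rw [Real.logb, div_le_iff₀ (Real.log_pos one_lt_two)]
    have h3 := Real.log_le_rpow_div (x := (M : ℝ)) (by positivity) (ε := 1 / 312) (by norm_num)
    have h4 : (1 : ℝ) / 2 ≤ Real.log 2 := by linarith [Real.log_two_gt_d9]
    have h5 : (0 : ℝ) ≤ (M : ℝ) ^ ((1 : ℝ) / 312) := by positivity
    nlinarith
  have h6 : (1 : ℝ) ≤ (M : ℝ) ^ ((1 : ℝ) / 312) := Real.one_le_rpow hM1 (by norm_num)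
  calc ((Nat.log 2 M + 1 : ℕ) : ℝ) ^ 39 ≤ (625 * (M : ℝ) ^ ((1 : ℝ) / 312)) ^ 39 := by
        gcongr
        push_cast
        linarith
    _ = 625 ^ 39 * (M : ℝ) ^ ((1 : ℝ) / 8) := by
      rw [mul_pow, ← Real.rpow_natCast ((M : ℝ) ^ ((1 : ℝ) / 312)), ← Real.rpow_mul (by positivity)]
      norm_num

/-- No `ε` is needed: the energy bound yields `1 / 42` up to logarithms, and the gap down to `1 /
48` absorbs them. -/
theorem exists_const_rpow_le_powerSumL1Norm :
    ∃ c : ℝ, 0 < c ∧ ∀ (p : ℕ), p.Prime → ∀ (g : ℤ), IsPrimitiveRootMod p g →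
      ∀ N : ℝ, 1 ≤ N → N < (p : ℝ) ^ ((1 : ℝ) / 2) →
        c * N ^ ((1 : ℝ) / 48) ≤ powerSumL1Norm p g N := by
  obtain ⟨C, hC⟩ : ∃ C : ℝ, C = 2 ^ 218 * 6 ^ 72 * 625 ^ 39 := ⟨_, rfl⟩
  have hC1 : 1 ≤ C := by rw [hC]; norm_num
  refine ⟨1 / (2 * C), by positivity, fun p hp g hg N hN hNp => ?_⟩
  have : Fact p.Prime := ⟨hp⟩
  have hp0 : (0 : ℝ) < p := by exact_mod_cast hp.pos
  have hg0 : (g : ZMod p) ≠ 0 := by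
    intro h
    rw [IsPrimitiveRootMod, h, orderOf_zero] at hg
    have := hp.two_le
    omega
  rw [powerSumL1Norm_eq hg0]
  set M := ⌊N⌋₊ with hMdef
  have hM : 1 ≤ M := Nat.le_floor (by exact_mod_cast hN)
  have hM0 : (0 : ℝ) < M := by exact_mod_cast hM
  have hMN : (M : ℝ) ≤ N := Nat.floor_le (by linarith)
  have hMp : M ^ 2 < p := by
    rw [← Real.sqrt_eq_rpow] at hNp
    have := (Real.lt_sqrt hM0.le).mp (hMN.trans_lt hNp)
    exact_mod_cast this
  have hinj : Set.InjOn (fun n : ℕ => (g : ZMod p) ^ n) (range M) := by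
    intro i hi j hj h
    rw [Finset.mem_coe, Finset.mem_range] at hi hj
    have hle : M ≤ p - 1 := by
      have : M ≤ M ^ 2 := Nat.le_self_pow two_ne_zero M
      omega
    refine pow_injOn_Iio_orderOf ?_ ?_ h
    · rw [Set.mem_Iio, hg]; omega
    · rw [Set.mem_Iio, hg]; omega
  have hE := familyEnergy_powers_pow_le hg0 hM hMp.le hinj
  have hH := card_pow_three_le_sum_norm_sq_mul_energy hinj
  rw [Finset.card_range] at hH
  set S := ∑ t, ‖familyExpSum (range M) (fun n : ℕ => (g : ZMod p) ^ n) t‖ with hS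
  have hS0 : 0 ≤ S := Finset.sum_nonneg fun _ _ => norm_nonneg _
  set e : ℝ := (familyEnergy (range M) (fun n : ℕ => (g : ZMod p) ^ n) : ℝ) with he
  have he0 : 0 ≤ e := Nat.cast_nonneg _
  set l := 1 / (p : ℝ) * S with hl
  have hl0 : 0 ≤ l := by positivity
  have h1 : (M : ℝ) ^ 3 ≤ l ^ 2 * e := by
    have h : (p : ℝ) ^ 3 * (l ^ 2 * e) = S ^ 2 * (p * e) := by
      rw [hl]; field_simp
    rw [← h, mul_pow] at hH
    exact le_of_mul_le_mul_left hH (by positivity)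
  -- The 21st power of `h1` meets the bound on `e ^ 21`; of `M ^ 63` against `M ^ 62`, one factor
  -- `M` survives.
  have h2 : (M : ℝ) ≤ l ^ 42 * (C * (M : ℝ) ^ ((1 : ℝ) / 8)) := by
    refine le_of_mul_le_mul_right ?_ (by positivity : (0 : ℝ) < M ^ 62)
    calc (M : ℝ) * M ^ 62 = (M ^ 3) ^ 21 := by ring
      _ ≤ (l ^ 2 * e) ^ 21 := by gcongr
      _ = l ^ 42 * e ^ 21 := by ring
      _ ≤ l ^ 42 * (2 ^ 218 * 6 ^ 72 * (625 ^ 39 * (M : ℝ) ^ ((1 : ℝ) / 8)) * (M : ℝ) ^ 62) := by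
        gcongr
        refine hE.trans ?_
        gcongr
        exact natLog_two_add_one_pow_le hM
      _ = l ^ 42 * (C * (M : ℝ) ^ ((1 : ℝ) / 8)) * M ^ 62 := by rw [hC]; ring
  have h3 : (M : ℝ) ^ ((7 : ℝ) / 8) ≤ C * l ^ 42 := by
    have h4 : (0 : ℝ) < (M : ℝ) ^ ((1 : ℝ) / 8) := by positivity
    refine le_of_mul_le_mul_right ?_ h4
    rw [← Real.rpow_add hM0]
    norm_num
    linarith
  have h5 : N ^ ((7 : ℝ) / 8) ≤ 2 * (M : ℝ) ^ ((7 : ℝ) / 8) := by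
    have h6 : N ≤ 2 * M := by
      have := Nat.lt_floor_add_one N
      have h7 : (1 : ℝ) ≤ M := by exact_mod_cast hM
      linarith
    calc N ^ ((7 : ℝ) / 8) ≤ (2 * (M : ℝ)) ^ ((7 : ℝ) / 8) := by gcongr
      _ = 2 ^ ((7 : ℝ) / 8) * (M : ℝ) ^ ((7 : ℝ) / 8) := Real.mul_rpow (by norm_num) hM0.le
      _ ≤ 2 ^ (1 : ℝ) * (M : ℝ) ^ ((7 : ℝ) / 8) := by gcongr <;> norm_num
      _ = _ := by rw [Real.rpow_one]
  have hc1 : 1 / (2 * C) ≤ 1 := by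
    rw [div_le_one (by positivity)]
    linarith
  refine le_of_pow_le_pow_left₀ (n := 42) (by norm_num) hl0 ?_
  calc (1 / (2 * C) * N ^ ((1 : ℝ) / 48)) ^ 42 = (1 / (2 * C)) ^ 42 * N ^ ((7 : ℝ) / 8) := by
        rw [mul_pow, ← Real.rpow_natCast (N ^ ((1 : ℝ) / 48)), ← Real.rpow_mul (by linarith)]
        norm_num
    _ ≤ (1 / (2 * C)) * (2 * (C * l ^ 42)) := by
        gcongr
        · exact pow_le_of_le_one (by positivity) hc1 (by norm_num)
        · linarith
    _ = l ^ 42 := by field_simp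

theorem theorem5 :
    ∀ ε : ℝ, 0 < ε → ∃ c : ℝ, 0 < c ∧
      ∀ (p : ℕ), p.Prime → ∀ (g : ℤ), IsPrimitiveRootMod p g →
        ∀ N : ℝ, 1 ≤ N → N < (p : ℝ) ^ ((1 : ℝ) / 2) →
          c * N ^ ((1 : ℝ) / 48 - ε) ≤ powerSumL1Norm p g N := by
  intro ε hε
  obtain ⟨c, hc, h⟩ := exists_const_rpow_le_powerSumL1Norm
  refine ⟨c, hc, fun p hp g hg N hN hNp => le_trans ?_ (h p hp g hg N hN hNp)⟩
  gcongr
  linarith
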